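/- **Theorem (Odontoceti maintains liveness).** *Setting.* There are $n=5f+1$ validators $0,\dots,5f$, at most $f$ of them Byzantine, the others honest. A block has an author, a round, a payload and a list of parents; it carries its causal history. Blocks of the first round have no parents; a valid block of a later round has as parents distinct valid blocks of the directly preceding round, the first one by the same author, from at least $4f+1$ validators. Every validator keeps a local DAG, finite at any time, of valid blocks, closed under parents; blocks never leave it. An honest author's block is produced by that author strictly before anyone else receives it. The network is partially synchronous: for a known $\Delta>0$ and an unknown time GST, a block (with its causal history) that an honest validator broadcasts at time $t$ reaches all honest validators by time $\max(t,\mathrm{GST})+\Delta$. *Leaders.* Each round has $k$ leader slots, $1\le k\le 4f+1$; the leader of rank $l<k$ in round $r$ is validator $(r+l)\bmod n$, and rank $0$ is the highest. *Block production.* An honest validator produces exactly one block per round, the first one at time $0$. It produces its block of round $r+1$ as soon as it has its own block of round $r$, has round-$r$ blocks of $4f+1$ validators, and has stopped waiting for the leaders of round $r$. It stops waiting when (i) for each of these $k$ leaders it has either a round-$r$ block of that leader or round-$(r+1)$ blocks of $2f+1$ other validators that reference no block of that leader, or (ii) $2\Delta$ have passed since it first had round-$r$ blocks of $4f+1$ validators.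 Its block references at least one block of every leader of round $r$ from whom it has one. *Decisions.* A validator classifies the slots by means of its local DAG, from the highest round down and from the lowest to the highest rank; thresholds count distinct authors. A round-$(r+1)$ block supports a round-$r$ leader block if it has it as a parent and blames it otherwise. A slot of round $r$ is directly committed to a block with $4f+1$ supports. It is directly skipped if blocks of $4f+1$ validators are present in round $r+1$ and every block of the slot has $4f+1$ blames. Otherwise let the anchor be the first slot, by round and then rank, in rounds $\ge r+2$ that is not skipped. If the anchor is committed, the slot is committed to a block of it that has $2f+1$ supports in the causal history of the anchor's block, and skipped if there is no such block; if the anchor is undecided or does not exist, the slot stays undecided. The leader sequence of a validator consists of the committed leader blocks, by round and then rank, before the first undecided slot. Say that round $r$ is *after GST* if at no time before GST any honest validator had round-$r$ blocks of $4f+1$ validators. *Claim.* 1. Any $2f+2$ consecutive rounds contain two consecutive rounds whose leaders of rank $0$ are honest. In every execution, moreover: 2. Every honest validator produces a block in every round, and all but finitely many rounds are after GST. 3. If round $r$ is after GST and the leader of some slot of round $r$ is honest, then its block $b$ of round $r$ is supported by the round-$(r+1)$ blocks of all honest validators; and from some time on, all honest validators directly commit the slot to $b$, assign it the status "committed to $b$",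 and have $b$ in their leader sequences. 4. For every leader slot of every round there is a time from which on no honest validator has the slot undecided. 5. If round $s$ is after GST, then among the rounds $s,\dots,s+2f+1$ there are two consecutive rounds with honest leaders of rank $0$ whose blocks are, from some time on, directly committed and in the leader sequences of all honest validators. -/

import Mathlib

open scoped NNReal

namespace Odontoceti

/-- A block: author, round number, payload, and list of parents. References are resolved: a hash
is identified with the block it points to, so that a block carries its causal history (collision
resistance of the hash function). -/
inductive Block (V P : Type) : Type
  | mk (author : V) (round : ℕ) (payload : P) (parents : List (Block V P)) : Block V P

namespace Block

variable {V P : Type}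

def author : Block V P → V
  | mk a _ _ _ => a

def round : Block V P → ℕ
  | mk _ r _ _ => r

def payload : Block V P → P
  | mk _ _ p _ => p

def parents : Block V P → List (Block V P)
  | mk _ _ _ ps => ps

end Block

/-- The `5 f + 1` validators. -/
abbrev Validator (f : ℕ) : Type := Fin (5 * f + 1)

/-- Blocks of the committee of `5 f + 1` validators, with payloads in `P`. -/
abbrev Blk (f : ℕ) (P : Type) : Type := Block (Validator f) P

noncomputable section

variable {f : ℕ} {P : Type}

open scoped Classical in
/-- The number of distinct authors of the blocks in `D` that have the property `p`.
All thresholds count validators, so that equivocation does not inflate a count. -/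
def authorCount (D : Finset (Blk f P)) (p : Blk f P → Prop) : ℕ :=
  ((D.filter p).image Block.author).card

open scoped Classical in
/-- Valid blocks. In the first round (round `0`) a block has no parents; afterwards its parents are
distinct valid blocks of the directly preceding round, the first one is a block of the same author,
and they come from at least `4 f + 1` validators. -/
inductive Valid : Blk f P → Prop
  | genesis (v : Validator f) (p : P) : Valid (.mk v 0 p [])
  | step (v : Validator f) (r : ℕ) (p : P) (own : Blk f P) (others : List (Blk f P))
      (hvalid : ∀ c ∈ own :: others, Valid c)
      (hround : ∀ c ∈ own :: others, c.round = r)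
      (hdistinct : (own :: others).Nodup)
      (hown : own.author = v)
      (hquorum : 4 * f + 1 ≤ ((own :: others).map Block.author).toFinset.card) :
      Valid (.mk v (r + 1) p (own :: others))

/-- Round-robin schedule: the leader of rank `l` (rank `0` is the highest) in round `r`. -/
def leader (f r l : ℕ) : Validator f :=
  ⟨(r + l) % (5 * f + 1), Nat.mod_lt _ (Nat.succ_pos _)⟩

/-- `c` supports `b`: it has `b` as a parent. Otherwise it blames `b`. -/
def Supports (c b : Blk f P) : Prop := b ∈ c.parents

/-- There is a path of parent references from `new` down to `old`. -/
def Link (old new : Blk f P) : Prop :=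
  Relation.ReflTransGen (fun a b : Blk f P => a ∈ b.parents) old new

open scoped Classical in
/-- The blocks of the leader slot of round `r` and rank `l` that are in `D`
(possibly none, possibly several if the leader equivocates). -/
def slotBlocks (D : Finset (Blk f P)) (r l : ℕ) : Finset (Blk f P) :=
  D.filter fun b => b.round = r ∧ b.author = leader f r l

/-! ### The decision rule, as a function of the local DAG `D` -/

/-- The status of a leader slot. -/
inductive Status (f : ℕ) (P : Type) : Type
  | commit (b : Blk f P) : Status f P
  | skip : Status f P
  | undecided : Status f P

/-- `b` has supports from `4 f + 1` validators in the decision round of its wave. -/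
def SupportedLeader (D : Finset (Blk f P)) (b : Blk f P) : Prop :=
  4 * f + 1 ≤ authorCount D fun c => c.round = b.round + 1 ∧ Supports c b

/-- `b` has blames from `4 f + 1` validators in the decision round of its wave. -/
def SkippedLeader (D : Finset (Blk f P)) (b : Blk f P) : Prop :=
  4 * f + 1 ≤ authorCount D fun c => c.round = b.round + 1 ∧ ¬ Supports c b

/-- Blocks of `2 f + 1` validators in the decision round of `b`'s wave both support `b` and lie in
the causal history of `anchor`. -/
def ThickLink (D : Finset (Blk f P)) (anchor b : Blk f P) : Prop :=
  2 * f + 1 ≤ authorCount D fun c => c.round = b.round + 1 ∧ Supports c b ∧ Link c anchor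

open scoped Classical in
/-- Direct decision of the slot of round `r` and rank `l`: commit a block with `4 f + 1` supports;
skip the slot if it has `4 f + 1` blames, i.e. blocks of `4 f + 1` validators are present in the
decision round and every block of the slot is blamed by `4 f + 1` validators (this includes the
empty slot). -/
def directDecide (D : Finset (Blk f P)) (r l : ℕ) : Status f P :=
  if h : ∃ b ∈ slotBlocks D r l, SupportedLeader D b then .commit h.choose
  else if 4 * f + 1 ≤ authorCount D (fun c => c.round = r + 1) ∧
      ∀ b ∈ slotBlocks D r l, SkippedLeader D b then .skip
  else .undecided

/-- A leader slot with its status. -/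
structure Entry (f : ℕ) (P : Type) : Type where
  round : ℕ
  rank : ℕ
  status : Status f P

open scoped Classical in
/-- Indirect decision of the slot of round `r` and rank `l`. `S` lists the later slots, with their
statuses, by round and then rank. The anchor is the first slot after the wave of round `r` that is
not skipped; a decision is made only if the anchor is committed. -/
def indirectDecide (D : Finset (Blk f P)) (r l : ℕ) (S : List (Entry f P)) : Status f P :=
  match (S.find? fun s => decide (r + 1 < s.round ∧ s.status ≠ .skip)).map Entry.status with
  | some (.commit a) =>
      if h : ∃ b ∈ slotBlocks D r l, ThickLink D a b then .commit h.choose else .skip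
  | _ => .undecided

/-- Direct decision, and indirect decision if the former leaves the slot undecided. -/
def decideSlot (D : Finset (Blk f P)) (r l : ℕ) (S : List (Entry f P)) : Status f P :=
  match directDecide D r l with
  | .undecided => indirectDecide D r l S
  | s => s

/-- The statuses of all leader slots (`k` per round) up to the highest round of `D`, ordered by
round and then rank. They are computed from the lowest ranked slot of the highest round
backwards (`foldr` starts with the last element of the range). -/
def tryDecide (k : ℕ) (D : Finset (Blk f P)) : List (Entry f P) :=
  (List.range (D.sup Block.round + 1)).foldr
    (fun r S => (List.range k).foldr (fun l S' => ⟨r, l, decideSlot D r l S'⟩ :: S') S) []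

/-- The status of the slot of round `r` and rank `l` according to the DAG `D`. -/
def slotStatus (k : ℕ) (D : Finset (Blk f P)) (r l : ℕ) : Status f P :=
  (((tryDecide k D).find? fun s => decide (s.round = r ∧ s.rank = l)).map Entry.status).getD
    .undecided

open scoped Classical in
/-- The leader sequence: the committed leader blocks, by round and then rank, that precede the
first undecided slot. -/
def commitSequence (k : ℕ) (D : Finset (Blk f P)) : List (Blk f P) :=
  ((tryDecide k D).takeWhile fun s => decide (s.status ≠ .undecided)).filterMap fun s =>
    match s.status with
    | .commit b => some b
    | _ => none

/-! ### Block production and executions -/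

/-- `D` contains a round-`r` block authored by `v`. -/
def HasBlock (D : Finset (Blk f P)) (v : Validator f) (r : ℕ) : Prop :=
  ∃ b ∈ D, b.author = v ∧ b.round = r

/-- `D` contains round-`r` blocks of at least `4 f + 1` validators; this is what a validator needs
in order to enter round `r + 1`. -/
def HasQuorum (D : Finset (Blk f P)) (r : ℕ) : Prop :=
  4 * f + 1 ≤ authorCount D fun b => b.round = r

/-- For validator `v` with local DAG `D`, the leader of round `r` and rank `l` needs no further
waiting: a block of it has been received, or blames have been received from `2 f + 1` other
validators, that is, round-`(r + 1)` blocks without any reference to this leader. -/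
def LeaderResolved (D : Finset (Blk f P)) (v : Validator f) (r l : ℕ) : Prop :=
  (slotBlocks D r l).Nonempty ∨
    2 * f + 1 ≤ authorCount D fun c =>
      c.round = r + 1 ∧ c.author ≠ v ∧ ∀ b ∈ c.parents, b.author ≠ leader f r l

/-- At time `t`, validator `v`, whose local DAG at time `s` is `dag s`, can produce its block of
round `r + 1`: it has its own round-`r` block and round-`r` blocks of `4 f + 1` validators, and it
has stopped waiting for the `k` leaders of round `r`, either because they are all resolved or by
timeout: it has had `4 f + 1` round-`r` blocks for a time of `2 Δ`. -/
def CanProduce (k : ℕ) (Δ : ℝ≥0) (dag : ℝ≥0 → Finset (Blk f P)) (v : Validator f) (r : ℕ)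
    (t : ℝ≥0) : Prop :=
  HasBlock (dag t) v r ∧ HasQuorum (dag t) r ∧
    ((∀ l < k, LeaderResolved (dag t) v r l) ∨ ∃ s, s + 2 * Δ ≤ t ∧ HasQuorum (dag s) r)

/-- An execution of the protocol with `k` leaders per round, in which the validators in `byz` are
Byzantine and all others are honest, in a partially synchronous network. Only the DAGs of honest
validators are constrained; blocks of Byzantine authors may be arbitrary valid blocks that arrive
anywhere at any time. -/
structure Execution (f : ℕ) (P : Type) (k : ℕ) (Δ GST : ℝ≥0) (byz : Finset (Validator f)) where
  /-- `dag v t` is the local DAG of `v` at time `t`. -/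
  dag : Validator f → ℝ≥0 → Finset (Blk f P)
  mono : ∀ v ∉ byz, Monotone (dag v)
  /-- Every block enters a local DAG at a definite instant. -/
  enters : ∀ v ∉ byz, ∀ t, ∀ b ∈ dag v t, ∃ s ≤ t, b ∈ dag v s ∧ ∀ s' < s, b ∉ dag v s'
  /-- Only valid blocks are accepted. -/
  valid : ∀ v ∉ byz, ∀ t, ∀ b ∈ dag v t, Valid b
  /-- A block is accepted only together with its causal history. -/
  closed : ∀ v ∉ byz, ∀ t, ∀ b ∈ dag v t, ∀ c ∈ b.parents, c ∈ dag v t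
  /-- Signatures: a block of an honest author was produced by it before anyone else received it. -/
  authentic : ∀ u ∉ byz, ∀ v ∉ byz, u ≠ v → ∀ t, ∀ b ∈ dag u t, b.author = v →
    ∃ s < t, b ∈ dag v s
  /-- Honest validators produce at most one block per round. -/
  single : ∀ v ∉ byz, ∀ t, ∀ b ∈ dag v t, ∀ c ∈ dag v t,
    b.author = v → c.author = v → b.round = c.round → b = c
  /-- Honest validators produce their block of the first round at the start. -/
  start : ∀ v ∉ byz, ∀ t, HasBlock (dag v t) v 0
  /-- Honest validators produce the block of the next round exactly when they can. -/
  produce : ∀ v ∉ byz, ∀ r t, HasBlock (dag v t) v (r + 1) ↔ CanProduce k Δ (dag v) v r t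
  /-- When an honest validator produces a block, that block references a block of every leader of
  the preceding round from whom it then has one. -/
  include_leaders : ∀ v ∉ byz, ∀ r t, ∀ b ∈ dag v t, (∀ s < t, b ∉ dag v s) →
    b.author = v → b.round = r + 1 → ∀ l < k, (slotBlocks (dag v t) r l).Nonempty →
      ∃ c ∈ slotBlocks (dag v t) r l, Supports b c
  /-- Partial synchrony: a block broadcast by an honest validator at time `t` is received by all
  honest validators by time `max t GST + Δ`. -/
  delivery : ∀ v ∉ byz, ∀ u ∉ byz, ∀ t, ∀ b ∈ dag v t, b.author = v → b ∈ dag u (max t GST + Δ)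

/-- Round `r` falls after GST: before GST no honest validator had received the `4 f + 1` blocks of
round `r` with which it proceeds to round `r + 1`. -/
def Execution.AfterGST {k : ℕ} {Δ GST : ℝ≥0} {byz : Finset (Validator f)}
    (E : Execution f P k Δ GST byz) (r : ℕ) : Prop :=
  ∀ v ∉ byz, ∀ t < GST, ¬ HasQuorum (E.dag v t) r

end

end Odontoceti

/-!
Liveness of Odontoceti rests on two facts.

*An honest leader of a round `r` after GST is supported by everybody.* Let `t₀` be the first time at
which some honest validator has a quorum of round `r`; then `GST ≤ t₀`. The honest blocks of this
quorum, at least `3 f + 1` of them, reach everybody by `t₀ + Δ`. A validator that has round-`r`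
blocks of `2 f + 1` validators also has its own one
(`Execution.hasBlock_of_forall_mem_hasBlock`): their parents form a quorum of the preceding round,
and each leader of that round is either referenced by one of these blocks, hence present, or blamed
by all of them. So every honest validator, in particular the leader, has its block of round `r` by
`t₀ + Δ`, and the leader's block is everywhere by `t₀ + 2 Δ`, no later than any timeout of round `r`
expires. An honest validator producing its next block without supporting the leader would therefore
have seen `2 f + 1` blames of other validators, one of which is honest and was produced strictly
earlier; the earliest honest blame gives a contradiction (`Execution.exists_supported_block`).
Once all honest blocks of round `r + 1` have arrived, the leader's block is directly committed.

*Two direct commits decide everything before them.* If the top-ranked slots of rounds `R` and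
`R + 1` are directly committed, then by backward induction every slot of a round below `R` is
decided: the search for its anchor stops at the latest at one of these two slots, and any slot
passed before that is already decided (`status_ne_undecided`).

Every window of `2 f + 2` rounds offers such a pair of honest leaders: for `f ≥ 1` the window is
shorter than the rotation of `5 f + 1` leaders, so each of the at most `f` Byzantine validators leads
in at most one of its rounds and spoils at most two of its `2 f + 1` pairs of consecutive rounds.
-/

namespace Odontoceti

variable {f k : ℕ} {P : Type}

/-! ### Leader schedule -/

theorem exists_consecutive_honest_leaders (byz : Finset (Validator f)) (hbyz : byz.card ≤ f)
    (s : ℕ) : ∃ r, s ≤ r ∧ r + 1 < s + (2 * f + 2) ∧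
      leader f r 0 ∉ byz ∧ leader f (r + 1) 0 ∉ byz := by
  by_contra! hcon
  have hpair : ∀ i < 2 * f + 1, leader f (s + i) 0 ∈ byz ∨ leader f (s + (i + 1)) 0 ∈ byz := by
    intro i hi
    by_contra! h
    exact h.2 (hcon (s + i) (by omega) (by omega) h.1)
  have hf : 1 ≤ f := by
    by_contra! h
    have h0 : byz = ∅ := Finset.card_eq_zero.1 (by omega)
    simpa [h0] using hpair 0 (by omega)
  let B := (Finset.range (2 * f + 2)).filter fun j => leader f (s + j) 0 ∈ byz
  have hB : B.card ≤ byz.card := by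
    refine Finset.card_le_card_of_injOn (fun j => leader f (s + j) 0)
      (fun j hj => (Finset.mem_filter.1 hj).2) ?_
    intro i hi j hj hij
    have hi' := Finset.mem_range.1 (Finset.mem_filter.1 hi).1
    have hj' := Finset.mem_range.1 (Finset.mem_filter.1 hj).1
    -- for `1 ≤ f` the window is no longer than the rotation: `2 * f + 2 ≤ 5 * f + 1`
    have hmod : s + i ≡ s + j [MOD 5 * f + 1] := by simpa [leader, Nat.ModEq] using hij
    exact (Nat.ModEq.add_left_cancel' s hmod).eq_of_lt_of_lt (by omega) (by omega)
  have hcover : Finset.range (2 * f + 1) ⊆ B ∪ B.image (· - 1) := by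
    intro i hi
    have hi' := Finset.mem_range.1 hi
    rcases hpair i hi' with h | h
    · exact Finset.mem_union_left _
        (Finset.mem_filter.2 ⟨Finset.mem_range.2 (by omega), h⟩)
    · exact Finset.mem_union_right _ (Finset.mem_image.2
        ⟨i + 1, Finset.mem_filter.2 ⟨Finset.mem_range.2 (by omega), h⟩, by simp⟩)
  have h1 := Finset.card_le_card hcover
  have h2 := Finset.card_union_le B (B.image (· - 1))
  have h3 : (B.image (· - 1)).card ≤ B.card := Finset.card_image_le
  rw [Finset.card_range] at h1
  omega

/-! ### Counting authors -/

theorem exists_finset_card_eq_authorCount (D : Finset (Blk f P)) (p : Blk f P → Prop) :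
    ∃ A : Finset (Validator f), A.card = authorCount D p ∧
      ∀ v, v ∈ A ↔ ∃ b ∈ D, p b ∧ b.author = v := by
  classical
  refine ⟨(D.filter p).image Block.author, ?_, fun v => by simp [and_assoc]⟩
  unfold authorCount
  congr

theorem card_le_authorCount {D : Finset (Blk f P)} {p : Blk f P → Prop}
    {A : Finset (Validator f)} (h : ∀ v ∈ A, ∃ b ∈ D, p b ∧ b.author = v) :
    A.card ≤ authorCount D p := by
  obtain ⟨A', hcard, hA'⟩ := exists_finset_card_eq_authorCount D p
  rw [← hcard]
  exact Finset.card_le_card fun v hv => (hA' v).2 (h v hv)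

theorem authorCount_mono {D D' : Finset (Blk f P)} (h : D ⊆ D') (p : Blk f P → Prop) :
    authorCount D p ≤ authorCount D' p := by
  obtain ⟨A, hcard, hA⟩ := exists_finset_card_eq_authorCount D p
  rw [← hcard]
  refine card_le_authorCount fun v hv => ?_
  obtain ⟨b, hb, hp⟩ := (hA v).1 hv
  exact ⟨b, h hb, hp⟩

theorem exists_author_notMem {D : Finset (Blk f P)} {p : Blk f P → Prop}
    {B : Finset (Validator f)} (h : B.card < authorCount D p) :
    ∃ b ∈ D, p b ∧ b.author ∉ B := by
  obtain ⟨A, hcard, hA⟩ := exists_finset_card_eq_authorCount D p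
  obtain ⟨v, hv, hvB⟩ := Finset.exists_mem_notMem_of_card_lt_card (hcard ▸ h)
  obtain ⟨b, hb, hp, rfl⟩ := (hA v).1 hv
  exact ⟨b, hb, hp, hvB⟩

theorem four_mul_add_one_le_card_compl {byz : Finset (Validator f)} (hbyz : byz.card ≤ f) :
    4 * f + 1 ≤ byzᶜ.card := by
  rw [Finset.card_compl, Fintype.card_fin]
  omega

theorem HasQuorum.mono {D D' : Finset (Blk f P)} {r : ℕ} (h : HasQuorum D r) (hD : D ⊆ D') :
    HasQuorum D' r :=
  le_trans h (authorCount_mono hD _)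

theorem HasBlock.mono {D D' : Finset (Blk f P)} {v : Validator f} {r : ℕ} (h : HasBlock D v r)
    (hD : D ⊆ D') : HasBlock D' v r := by
  obtain ⟨b, hb, h⟩ := h
  exact ⟨b, hD hb, h⟩

theorem HasQuorum.exists_finset {D : Finset (Blk f P)} {r : ℕ} (h : HasQuorum D r) :
    ∃ A : Finset (Validator f), 4 * f + 1 ≤ A.card ∧ ∀ v ∈ A, HasBlock D v r := by
  obtain ⟨A, hcard, hA⟩ := exists_finset_card_eq_authorCount D fun b => b.round = r
  refine ⟨A, hcard ▸ h, fun v hv => ?_⟩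
  obtain ⟨b, hb, hr, ha⟩ := (hA v).1 hv
  exact ⟨b, hb, ha, hr⟩

theorem hasQuorum_of_forall_hasBlock {D : Finset (Blk f P)} {r : ℕ} {A : Finset (Validator f)}
    (hA : 4 * f + 1 ≤ A.card) (h : ∀ v ∈ A, HasBlock D v r) : HasQuorum D r := by
  refine hA.trans (card_le_authorCount fun v hv => ?_)
  obtain ⟨b, hb, ha, hr⟩ := h v hv
  exact ⟨b, hb, hr, ha⟩

/-! ### Valid blocks -/

theorem Valid.round_parent {b c : Blk f P} (hb : Valid b) (hc : c ∈ b.parents) :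
    b.round = c.round + 1 := by
  cases hb with
  | genesis v p => simp [Block.parents] at hc
  | step v r p own others hvalid hround => rw [hround c hc, Block.round]

theorem Valid.exists_parent_authors {b : Blk f P} {r : ℕ} (hb : Valid b) (hr : b.round = r + 1) :
    ∃ A : Finset (Validator f), 4 * f + 1 ≤ A.card ∧
      ∀ v ∈ A, ∃ c ∈ b.parents, c.author = v ∧ c.round = r := by
  cases hb with
  | genesis v p => simp [Block.round] at hr
  | step v r' p own others hvalid hround hdistinct hown hquorum =>
    obtain rfl : r' = r := by simpa [Block.round] using hr
    refine ⟨_, hquorum, fun v hv => ?_⟩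
    obtain ⟨c, hc, rfl⟩ := List.mem_map.1 (List.mem_toFinset.1 hv)
    exact ⟨c, hc, rfl, hround c hc⟩

theorem mem_slotBlocks {D : Finset (Blk f P)} {r l : ℕ} {b : Blk f P} :
    b ∈ slotBlocks D r l ↔ b ∈ D ∧ b.round = r ∧ b.author = leader f r l := by
  simp [slotBlocks]

/-! ### Block production -/

section Execution

variable {Δ GST : ℝ≥0} {byz : Finset (Validator f)} (E : Execution f P k Δ GST byz)

theorem Execution.mem_dag_author {u : Validator f} (hu : u ∉ byz) {t : ℝ≥0} {b : Blk f P}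
    (hb : b ∈ E.dag u t) (ha : b.author ∉ byz) : b ∈ E.dag b.author t := by
  by_cases h : u = b.author
  · exact h ▸ hb
  · obtain ⟨s, hs, hbs⟩ := E.authentic u hu _ ha h t b hb rfl
    exact E.mono _ ha hs.le hbs

/-- Honest validators do not equivocate, across all local DAGs and times. -/
theorem Execution.eq_of_author_round {u u' : Validator f} (hu : u ∉ byz) (hu' : u' ∉ byz)
    {t t' : ℝ≥0} {b c : Blk f P} (hb : b ∈ E.dag u t) (hc : c ∈ E.dag u' t')
    (ha : b.author ∉ byz) (hac : b.author = c.author) (hr : b.round = c.round) : b = c := by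
  have hb' := E.mono _ ha (le_max_left t t') (E.mem_dag_author hu hb ha)
  have hc' := E.mem_dag_author hu' hc (hac ▸ ha)
  rw [← hac] at hc'
  exact E.single _ ha _ b hb' c (E.mono _ ha (le_max_right t t') hc') rfl hac.symm hr

theorem Execution.hasQuorum_of_mem {v : Validator f} (hv : v ∉ byz) {t : ℝ≥0} {b : Blk f P}
    (hb : b ∈ E.dag v t) {r : ℕ} (hr : b.round = r + 1) : HasQuorum (E.dag v t) r := by
  obtain ⟨A, hcard, hA⟩ := (E.valid v hv t b hb).exists_parent_authors hr
  refine hasQuorum_of_forall_hasBlock hcard fun w hw => ?_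
  obtain ⟨c, hc, h⟩ := hA w hw
  exact ⟨c, E.closed v hv t b hb c hc, h⟩

/-- Blocks of `2 f + 1` validators let an honest validator catch up with their round: it needs no
timeout, since these blocks resolve every leader of the preceding round. -/
theorem Execution.hasBlock_of_forall_mem_hasBlock {u : Validator f} (hu : u ∉ byz) {t : ℝ≥0}
    {r : ℕ} {A : Finset (Validator f)} (hA : 2 * f + 1 ≤ A.card)
    (h : ∀ w ∈ A, HasBlock (E.dag u t) w r) : HasBlock (E.dag u t) u r := by
  induction r generalizing A with
  | zero => exact E.start u hu t
  | succ r ih =>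
    by_cases huA : u ∈ A
    · exact h u huA
    obtain ⟨w, hw⟩ := Finset.card_pos.1 (by omega : 0 < A.card)
    obtain ⟨c, hc, -, hcr⟩ := h w hw
    have hq := E.hasQuorum_of_mem hu hc hcr
    obtain ⟨A', hA', hblk⟩ := hq.exists_finset
    refine (E.produce u hu r t).2 ⟨ih (by omega) hblk, hq, Or.inl fun l _ => ?_⟩
    by_cases hne : (slotBlocks (E.dag u t) r l).Nonempty
    · exact Or.inl hne
    refine Or.inr (hA.trans (card_le_authorCount fun w hw => ?_))
    obtain ⟨c, hc, hca, hcr⟩ := h w hw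
    refine ⟨c, hc, ⟨hcr, fun hcu => huA (hcu ▸ hca ▸ hw), fun b hb hbl => hne ⟨b, ?_⟩⟩, hca⟩
    have := (E.valid u hu t c hc).round_parent hb
    exact mem_slotBlocks.2 ⟨E.closed u hu t c hc b hb, by omega, hbl⟩

theorem Execution.exists_forall_hasBlock {r : ℕ}
    (h : ∀ v ∉ byz, ∃ t, HasBlock (E.dag v t) v r) :
    ∃ T, ∀ t ≥ T, ∀ u ∉ byz, ∀ v ∉ byz, HasBlock (E.dag u t) v r := by
  have h' : ∀ v, ∃ t, v ∉ byz → HasBlock (E.dag v t) v r := fun v => by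
    by_cases hv : v ∈ byz
    · exact ⟨0, fun hv' => absurd hv hv'⟩
    · exact (h v hv).imp fun t ht _ => ht
  choose τ hτ using h'
  refine ⟨max (Finset.univ.sup τ) GST + Δ, fun t ht u hu v hv => ?_⟩
  obtain ⟨b, hb, hba, hbr⟩ := hτ v hv
  have hle : τ v ≤ Finset.univ.sup τ := Finset.le_sup (Finset.mem_univ v)
  exact ⟨b, E.mono u hu ht (E.delivery v hv u hu _ b (E.mono v hv hle hb) hba), hba, hbr⟩

/-- Every honest validator eventually enters every round, at the latest by timeout. -/
theorem Execution.exists_hasBlock (hbyz : byz.card ≤ f) (r : ℕ) :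
    ∀ v ∉ byz, ∃ t, HasBlock (E.dag v t) v r := by
  induction r with
  | zero => exact fun v hv => ⟨0, E.start v hv 0⟩
  | succ r ih =>
    intro v hv
    obtain ⟨T, hT⟩ := E.exists_forall_hasBlock ih
    have hq : HasQuorum (E.dag v T) r :=
      hasQuorum_of_forall_hasBlock (four_mul_add_one_le_card_compl hbyz)
        fun w hw => hT T le_rfl v hv w (Finset.mem_compl.1 hw)
    have hle : T ≤ T + 2 * Δ := le_self_add
    exact ⟨T + 2 * Δ, (E.produce v hv r _).2 ⟨hT _ hle v hv v hv,
      hq.mono (E.mono v hv hle), Or.inr ⟨T, le_rfl, hq⟩⟩⟩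

theorem Execution.exists_forall_ge_hasBlock (hbyz : byz.card ≤ f) (r : ℕ) :
    ∃ T, ∀ t ≥ T, ∀ u ∉ byz, ∀ v ∉ byz, HasBlock (E.dag u t) v r :=
  E.exists_forall_hasBlock (E.exists_hasBlock hbyz r)

/-! ### Rounds after GST -/

theorem Execution.AfterGST.mono {E : Execution f P k Δ GST byz} {r s : ℕ} (h : E.AfterGST r)
    (hrs : r ≤ s) : E.AfterGST s := by
  induction s, hrs using Nat.le_induction with
  | base => exact h
  | succ s _ ih =>
    intro v hv t ht hq
    obtain ⟨b, hb, hbr, -⟩ := exists_author_notMem (B := ∅)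
      (lt_of_lt_of_le (by simp) (show 4 * f + 1 ≤ _ from hq))
    exact ih v hv t ht (E.hasQuorum_of_mem hv hb hbr)

theorem Execution.exists_afterGST : ∃ R, ∀ r, R ≤ r → E.AfterGST r := by
  refine ⟨Finset.univ.sup (fun v => (E.dag v GST).sup Block.round) + 1, fun r hr v hv t ht hq => ?_⟩
  obtain ⟨b, hb, hbr, -⟩ := exists_author_notMem (B := ∅)
    (lt_of_lt_of_le (by simp) (show 4 * f + 1 ≤ _ from hq))
  have h1 : b.round ≤ (E.dag v GST).sup Block.round := Finset.le_sup (E.mono v hv ht.le hb)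
  have h2 : (E.dag v GST).sup Block.round ≤
      Finset.univ.sup fun v => (E.dag v GST).sup Block.round :=
    Finset.le_sup (f := fun v => (E.dag v GST).sup Block.round) (Finset.mem_univ v)
  omega

/-- A monotone property of a local DAG that holds at some time has a first time at which it holds,
because the blocks of a DAG enter it at definite instants and are finitely many. -/
theorem Execution.exists_first_time {v : Validator f} (hv : v ∉ byz)
    {Q : Finset (Blk f P) → Prop} (hQ : ∀ D D', D ⊆ D' → Q D → Q D') {T : ℝ≥0}
    (hT : Q (E.dag v T)) :
    ∃ t₀, Q (E.dag v t₀) ∧ ∀ t, Q (E.dag v t) → t₀ ≤ t := by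
  classical
  have h : ∀ b, ∃ s, b ∈ E.dag v T → b ∈ E.dag v s ∧ ∀ s' < s, b ∉ E.dag v s' := fun b => by
    by_cases hb : b ∈ E.dag v T
    · obtain ⟨s, -, hs⟩ := E.enters v hv T b hb
      exact ⟨s, fun _ => hs⟩
    · exact ⟨0, fun hb' => absurd hb' hb⟩
  choose e he using h
  -- the first time is the least time by which some sub-DAG with the property has entered
  obtain ⟨D, hD, hmin⟩ := Finset.exists_min_image ((E.dag v T).powerset.filter Q)
    (fun D => D.sup e) ⟨_, Finset.mem_filter.2 ⟨Finset.mem_powerset_self _, hT⟩⟩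
  have hsub := Finset.mem_powerset.1 (Finset.mem_filter.1 hD).1
  refine ⟨D.sup e, hQ D _ (fun b hb => E.mono v hv (Finset.le_sup hb) (he b (hsub hb)).1)
    (Finset.mem_filter.1 hD).2, fun t ht => ?_⟩
  have hle : ∀ t ≤ T, Q (E.dag v t) → D.sup e ≤ t := fun t htT ht =>
    (hmin _ (Finset.mem_filter.2 ⟨Finset.mem_powerset.2 (E.mono v hv htT), ht⟩)).trans
      (Finset.sup_le fun b hb => le_of_not_gt fun hlt => (he b (E.mono v hv htT hb)).2 t hlt hb)
  rcases le_total t T with h | h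
  · exact hle t h ht
  · exact (hle T le_rfl hT).trans h

/-- All honest validators enter a round after GST within `Δ` of the first time `t₀` at which one of
them has a quorum of that round. -/
theorem Execution.AfterGST.exists_first_quorum {E : Execution f P k Δ GST byz}
    (hbyz : byz.card ≤ f) {r : ℕ} (hr : E.AfterGST r) :
    ∃ t₀, GST ≤ t₀ ∧ (∀ v ∉ byz, ∀ t, HasQuorum (E.dag v t) r → t₀ ≤ t) ∧
      ∀ u ∉ byz, HasBlock (E.dag u (t₀ + Δ)) u r := by
  obtain ⟨T, hT⟩ := E.exists_forall_ge_hasBlock hbyz r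
  have hcard := four_mul_add_one_le_card_compl hbyz
  have hfirst : ∀ v, ∃ t₀, v ∉ byz →
      HasQuorum (E.dag v t₀) r ∧ ∀ t, HasQuorum (E.dag v t) r → t₀ ≤ t := fun v => by
    by_cases hv : v ∈ byz
    · exact ⟨0, fun hv' => absurd hv hv'⟩
    have hq : HasQuorum (E.dag v T) r := hasQuorum_of_forall_hasBlock hcard
      fun w hw => hT T le_rfl v hv w (Finset.mem_compl.1 hw)
    obtain ⟨t₀, ht₀⟩ := E.exists_first_time hv (Q := fun D => HasQuorum D r)
      (fun D D' hD h => h.mono hD) hq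
    exact ⟨t₀, fun _ => ht₀⟩
  choose τ hτ using hfirst
  obtain ⟨v, hv, hmin⟩ := Finset.exists_min_image byzᶜ τ (Finset.card_pos.1 (by omega))
  rw [Finset.mem_compl] at hv
  have hGST : GST ≤ τ v := le_of_not_gt fun hlt => hr v hv _ hlt (hτ v hv).1
  refine ⟨τ v, hGST, fun w hw t ht =>
    (hmin w (Finset.mem_compl.2 hw)).trans ((hτ w hw).2 t ht), fun u hu => ?_⟩
  obtain ⟨A, hA, hblk⟩ := (hτ v hv).1.exists_finset
  -- only the honest part of the quorum is certain to be delivered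
  have hA' : 2 * f + 1 ≤ (A \ byz).card := by
    have := Finset.le_card_sdiff byz A
    omega
  refine E.hasBlock_of_forall_mem_hasBlock hu hA' fun w hw => ?_
  obtain ⟨hwA, hwb⟩ := Finset.mem_sdiff.1 hw
  obtain ⟨b, hb, rfl, hbr⟩ := hblk w hwA
  have := E.delivery _ hwb u hu _ b (E.mem_dag_author hv hb hwb) rfl
  rw [max_eq_left hGST] at this
  exact ⟨b, this, rfl, hbr⟩

/-- The block of an honest leader of a round after GST is supported by all honest validators. -/
theorem Execution.exists_supported_block (hbyz : byz.card ≤ f) {r : ℕ} (hr : E.AfterGST r) {l : ℕ}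
    (hl : l < k) (hL : leader f r l ∉ byz) :
    ∃ b : Blk f P, b.author = leader f r l ∧ b.round = r ∧ (∃ t, b ∈ E.dag (leader f r l) t) ∧
      ∀ v ∉ byz, ∀ t, ∀ c ∈ E.dag v t, c.author = v → c.round = r + 1 → Supports c b := by
  obtain ⟨t₀, hGST, hfirst, hall⟩ := hr.exists_first_quorum hbyz
  obtain ⟨b, hb, hba, hbr⟩ := hall _ hL
  refine ⟨b, hba, hbr, ⟨_, hb⟩, ?_⟩
  by_contra! hcon
  let Bad : Validator f → ℝ≥0 → Prop := fun v s =>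
    ∃ c ∈ E.dag v s, c.author = v ∧ c.round = r + 1 ∧ ¬ Supports c b
  have hbad : ∀ v, ∃ s, v ∉ byz → (∃ t, Bad v t) → Bad v s ∧ ∀ s', Bad v s' → s ≤ s' := fun v => by
    by_cases h : v ∉ byz ∧ ∃ t, Bad v t
    · obtain ⟨hv, T, hT⟩ := h
      obtain ⟨s, hs⟩ := E.exists_first_time hv
        (Q := fun D => ∃ c ∈ D, c.author = v ∧ c.round = r + 1 ∧ ¬ Supports c b)
        (fun D D' hD ⟨c, hc, h⟩ => ⟨c, hD hc, h⟩) hT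
      exact ⟨s, fun _ _ => hs⟩
    · exact ⟨0, fun hv ht => absurd ⟨hv, ht⟩ h⟩
  choose τ hτ using hbad
  classical
  obtain ⟨v₀, hv₀, t, c, hc, hca, hcr, hcb⟩ := hcon
  -- the honest validator that is the first to produce a block without supporting `b`
  obtain ⟨v, hv, hmin⟩ := Finset.exists_min_image
    (Finset.univ.filter fun v => v ∉ byz ∧ ∃ t, Bad v t) τ
    ⟨v₀, by simpa using ⟨hv₀, t, c, hc, hca, hcr, hcb⟩⟩
  obtain ⟨hv, hvbad⟩ := (Finset.mem_filter.1 hv).2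
  obtain ⟨⟨c, hc, hca, hcr, hcb⟩, hcfirst⟩ := hτ v hv hvbad
  have hempty : ¬ (slotBlocks (E.dag v (τ v)) r l).Nonempty := fun hne => by
    obtain ⟨c', hc', hsupp⟩ := E.include_leaders v hv r (τ v) c hc
      (fun s hs hcs => absurd (hcfirst s ⟨c, hcs, hca, hcr, hcb⟩) (not_le_of_gt hs)) hca hcr l hl hne
    obtain ⟨hc'D, hc'r, hc'a⟩ := mem_slotBlocks.1 hc'
    have : c' = b := E.eq_of_author_round hv hL hc'D hb (hc'a ▸ hL) (hc'a.trans hba.symm)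
      (hc'r.trans hbr.symm)
    exact hcb (this ▸ hsupp)
  obtain ⟨-, -, hres | ⟨s, hs, hq⟩⟩ := (E.produce v hv r (τ v)).1 ⟨c, hc, hca, hcr⟩
  · rcases hres l hl with hne | hblame
    · exact hempty hne
    obtain ⟨c', hc', ⟨hc'r, hc'v, hc'b⟩, hw⟩ := exists_author_notMem (B := byz)
      (lt_of_lt_of_le (by omega) hblame)
    obtain ⟨s, hs, hc's⟩ := E.authentic v hv _ hw (Ne.symm hc'v) _ c' hc' rfl
    have hbad' : Bad c'.author s := ⟨c', hc's, rfl, hc'r, fun h => hc'b b h hba⟩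
    have h1 := hmin c'.author (Finset.mem_filter.2 ⟨Finset.mem_univ _, hw, s, hbad'⟩)
    have h2 := (hτ _ hw ⟨s, hbad'⟩).2 s hbad'
    exact absurd (h1.trans h2) (not_le_of_gt hs)
  · have hbv := E.delivery _ hL v hv _ b hb hba
    rw [max_eq_left (hGST.trans le_self_add)] at hbv
    have hle : t₀ + Δ + Δ ≤ τ v := by
      refine le_trans ?_ hs
      rw [add_assoc, ← two_mul]
      gcongr
      exact hfirst v hv s hq
    exact hempty ⟨b, mem_slotBlocks.2 ⟨E.mono v hv hle hbv, hbr, hba⟩⟩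

end Execution

/-! ### Decisions of a local DAG -/

section Decisions

variable (k : ℕ) (D : Finset (Blk f P))

/-- The leader slots of the rounds up to the highest round of `D`, by round and then rank. -/
def slots : List (ℕ × ℕ) :=
  List.range (D.sup Block.round + 1) ×ˢ List.range k

/-- The statuses of the slots in `L`, each one computed from those of the slots after it. -/
noncomputable def entries (L : List (ℕ × ℕ)) : List (Entry f P) :=
  L.foldr (fun p S => ⟨p.1, p.2, decideSlot D p.1 p.2 S⟩ :: S) []

variable {k D}

theorem entries_cons (p : ℕ × ℕ) (L : List (ℕ × ℕ)) :
    entries D (p :: L) = ⟨p.1, p.2, decideSlot D p.1 p.2 (entries D L)⟩ :: entries D L :=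
  rfl

theorem tryDecide_eq_entries : tryDecide k D = entries D (slots k D) := by
  unfold tryDecide entries slots
  generalize D.sup Block.round + 1 = N
  generalize ([] : List (Entry f P)) = S₀
  generalize List.range N = L
  induction L with
  | nil => rfl
  | cons r L ih =>
    rw [List.foldr_cons, ih, List.product_cons, List.foldr_append, List.foldr_map]

theorem mem_slots {r l : ℕ} : (r, l) ∈ slots k D ↔ r ≤ D.sup Block.round ∧ l < k := by
  unfold slots
  refine List.pair_mem_product.trans ?_
  rw [List.mem_range, List.mem_range, Nat.lt_succ_iff]

theorem pairwise_slots : (slots k D).Pairwise fun p q => Prod.Lex (· < ·) (· < ·) p q := by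
  unfold slots
  refine List.pairwise_flatMap.2 ⟨fun r _ => ?_, List.pairwise_lt_range.imp fun hrs => ?_⟩
  · exact List.pairwise_map.2 (List.pairwise_lt_range.imp fun h => Prod.Lex.right _ h)
  · simp only [List.mem_map]
    rintro _ ⟨l, -, rfl⟩ _ ⟨l', -, rfl⟩
    exact Prod.Lex.left _ _ hrs

theorem map_entries (L : List (ℕ × ℕ)) :
    (entries D L).map (fun e => (e.round, e.rank)) = L := by
  induction L with
  | nil => rfl
  | cons p L ih => rw [entries_cons, List.map_cons, ih]

theorem exists_mem_entries {L : List (ℕ × ℕ)} {r l : ℕ} (h : (r, l) ∈ L) :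
    ∃ e ∈ entries D L, e.round = r ∧ e.rank = l := by
  rw [← map_entries (D := D) L] at h
  obtain ⟨e, he, heq⟩ := List.mem_map.1 h
  exact ⟨e, he, congrArg Prod.fst heq, congrArg Prod.snd heq⟩

theorem pairwise_entries {L : List (ℕ × ℕ)}
    (hL : L.Pairwise fun p q => Prod.Lex (· < ·) (· < ·) p q) :
    (entries D L).Pairwise fun e e' => e.round < e'.round ∨ e.round = e'.round ∧
      e.rank < e'.rank := by
  rw [← map_entries (D := D) L, List.pairwise_map] at hL
  exact hL.imp fun h => Prod.lex_def.1 h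

/-- A direct commit is the status of its slot, whatever the statuses of the later slots. -/
theorem status_eq_commit {L : List (ℕ × ℕ)} {e : Entry f P} (he : e ∈ entries D L) {b : Blk f P}
    (hb : directDecide D e.round e.rank = .commit b) : e.status = .commit b := by
  induction L with
  | nil => simp [entries] at he
  | cons p L ih =>
    rw [entries_cons, List.mem_cons] at he
    rcases he with rfl | he
    · simp only [decideSlot, hb]
    · exact ih he

theorem mem_slotBlocks_of_directDecide {r l : ℕ} {b : Blk f P}
    (h : directDecide D r l = .commit b) : b ∈ slotBlocks D r l := by
  unfold directDecide at h
  split_ifs at h with hex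
  rw [Status.commit.injEq] at h
  exact h ▸ hex.choose_spec.1

/-- In a list sorted by round and rank, the anchor is at or before any slot after the wave that is
not skipped. If the slots up to there are decided, then so is the anchor. -/
theorem indirectDecide_ne_undecided {r l : ℕ} {S : List (Entry f P)}
    (hS : S.Pairwise fun e e' => e.round < e'.round ∨ e.round = e'.round ∧ e.rank < e'.rank)
    {x : Entry f P} (hx : x ∈ S) (hxr : r + 1 < x.round) (hxs : x.status ≠ .skip)
    (hdec : ∀ e ∈ S, r + 1 < e.round →
      e = x ∨ e.round < x.round ∨ e.round = x.round ∧ e.rank < x.rank → e.status ≠ .undecided) :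
    indirectDecide D r l S ≠ .undecided := by
  unfold indirectDecide
  generalize hf : S.find? _ = o
  cases o with
  | none => simpa [hxr, hxs] using List.find?_eq_none.1 hf x hx
  | some e =>
    obtain ⟨hpe, as, bs, rfl, has⟩ := List.find?_eq_some_iff_append.1 hf
    have hpe : r + 1 < e.round ∧ e.status ≠ .skip := by simpa using hpe
    obtain ⟨her, hes⟩ := hpe
    have hex : e = x ∨ e.round < x.round ∨ e.round = x.round ∧ e.rank < x.rank := by
      rcases List.mem_append.1 hx with hx | hx
      · simpa [hxr, hxs] using has x hx
      rcases List.mem_cons.1 hx with rfl | hx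
      · exact Or.inl rfl
      · exact Or.inr (List.rel_of_pairwise_cons (List.pairwise_append.1 hS).2.1 hx)
    have hed := hdec e (by simp) her hex
    obtain ⟨r', l', st⟩ := e
    cases st with
    | skip => exact absurd rfl hes
    | undecided => exact absurd rfl hed
    | commit a =>
      simp only [Option.map_some]
      split_ifs <;> simp

theorem decideSlot_ne_undecided {r l : ℕ} {S : List (Entry f P)}
    (h : indirectDecide D r l S ≠ .undecided) : decideSlot D r l S ≠ .undecided := by
  unfold decideSlot
  split
  · exact h
  · assumption

/-- If the top-ranked slots of two consecutive rounds `R` and `R + 1` are directly committed, every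
slot of a round below `R` is decided. -/
theorem status_ne_undecided (hk : 1 ≤ k) {R : ℕ} {b b' : Blk f P}
    (hb : directDecide D R 0 = .commit b) (hb' : directDecide D (R + 1) 0 = .commit b')
    {e : Entry f P} (he : e ∈ tryDecide k D) (heR : e.round < R) : e.status ≠ .undecided := by
  rw [tryDecide_eq_entries] at he
  have hsup : R + 1 ≤ D.sup Block.round := by
    obtain ⟨hD, hr, -⟩ := mem_slotBlocks.1 (mem_slotBlocks_of_directDecide hb')
    exact hr ▸ Finset.le_sup (f := Block.round) hD
  suffices H : ∀ L, L <:+ slots k D → ∀ e ∈ entries D L, e.round < R → e.status ≠ .undecided from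
    H _ List.suffix_rfl e he heR
  intro L hL
  induction L with
  | nil => simp [entries]
  | cons p L ih =>
    have ih := ih ((List.suffix_cons p L).trans hL)
    obtain ⟨r, l⟩ := p
    intro e he heR
    rw [entries_cons, List.mem_cons] at he
    rcases he with rfl | he
    swap
    · exact ih e he heR
    simp only at heR ⊢
    refine decideSlot_ne_undecided ?_
    obtain ⟨pre, hpre⟩ := hL
    have hsorted := pairwise_slots (k := k) (D := D)
    rw [← hpre] at hsorted
    have hLsorted := (List.pairwise_append.1 hsorted).2.1.of_cons
    have hlater : ∀ r', r < r' → r' ≤ R + 1 → (r', 0) ∈ L := by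
      intro r' hrr' hr'
      have hmem : (r', 0) ∈ slots k D := mem_slots.2 ⟨hr'.trans hsup, hk⟩
      rw [← hpre, List.mem_append, List.mem_cons] at hmem
      rcases hmem with hmem | hmem | hmem
      · have := Prod.lex_def.1
          ((List.pairwise_append.1 hsorted).2.2 _ hmem (r, l) List.mem_cons_self)
        simp only at this
        omega
      · have := congrArg Prod.fst hmem
        simp only at this
        omega
      · exact hmem
    -- the slot of round `R` bounds the search, except that for `r + 1 = R` it is in the wave of `r`
    by_cases hrR : r + 1 < R
    · obtain ⟨x, hx, hxr, hxl⟩ := exists_mem_entries (D := D) (hlater R heR (by omega))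
      have hxs := status_eq_commit hx (hxr ▸ hxl ▸ hb)
      refine indirectDecide_ne_undecided (pairwise_entries hLsorted) hx (by omega) (by simp [hxs]) ?_
      rintro e he - (rfl | h)
      · simp [hxs]
      · exact ih e he (by omega)
    · obtain ⟨x, hx, hxr, hxl⟩ := exists_mem_entries (D := D) (hlater (R + 1) (by omega) le_rfl)
      have hxs := status_eq_commit hx (hxr ▸ hxl ▸ hb')
      refine indirectDecide_ne_undecided (pairwise_entries hLsorted) hx (by omega) (by simp [hxs]) ?_
      rintro e he her (rfl | h)
      · simp [hxs]
      · omega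

theorem exists_slotStatus_eq {r l : ℕ} (hr : r ≤ D.sup Block.round) (hl : l < k) :
    ∃ e ∈ tryDecide k D, e.round = r ∧ e.rank = l ∧ slotStatus k D r l = e.status := by
  unfold slotStatus
  obtain ⟨x, hx, hxr, hxl⟩ := exists_mem_entries (D := D) (mem_slots.2 ⟨hr, hl⟩)
  rw [← tryDecide_eq_entries] at hx
  generalize hf : (tryDecide k D).find? _ = o
  cases o with
  | none => simpa [hxr, hxl] using List.find?_eq_none.1 hf x hx
  | some e =>
    have hp := List.find?_some hf
    obtain ⟨her, hel⟩ : e.round = r ∧ e.rank = l := by simpa using hp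
    exact ⟨e, List.mem_of_find?_eq_some hf, her, hel, rfl⟩

theorem mem_commitSequence {e : Entry f P} (he : e ∈ tryDecide k D) {b : Blk f P}
    (hb : e.status = .commit b)
    (hdec : ∀ e' ∈ tryDecide k D, e'.round ≤ e.round → e'.status ≠ .undecided) :
    b ∈ commitSequence k D := by
  have hsorted := pairwise_entries (D := D) (pairwise_slots (k := k) (D := D))
  rw [← tryDecide_eq_entries] at hsorted
  unfold commitSequence
  refine List.mem_filterMap.2 ⟨e, ?_, by simp [hb]⟩
  obtain ⟨as, bs, heq⟩ := List.append_of_mem he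
  rw [heq] at hsorted hdec ⊢
  rw [List.takeWhile_append_of_pos, List.takeWhile_cons_of_pos]
  · simp
  · simpa using hdec e (by simp) le_rfl
  · intro a ha
    have := (List.pairwise_append.1 hsorted).2.2 a ha e List.mem_cons_self
    simpa using hdec a (by simp [ha]) (by omega)

end Decisions

/-! ### Eventual decisions -/

section Execution

variable {Δ GST : ℝ≥0} {byz : Finset (Validator f)} (E : Execution f P k Δ GST byz)

theorem Execution.eventually_directDecide (hbyz : byz.card ≤ f) {r : ℕ} (hr : E.AfterGST r) {l : ℕ}
    (hl : l < k) (hL : leader f r l ∉ byz) :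
    ∃ b : Blk f P, b.author = leader f r l ∧ b.round = r ∧
      (∀ v ∉ byz, ∀ t, ∀ c ∈ E.dag v t, c.author = v → c.round = r + 1 → Supports c b) ∧
      ∀ᶠ t in Filter.atTop, ∀ v ∉ byz, directDecide (E.dag v t) r l = .commit b := by
  obtain ⟨b, hba, hbr, ⟨t₁, hbt⟩, hsupp⟩ := E.exists_supported_block hbyz hr hl hL
  refine ⟨b, hba, hbr, hsupp, ?_⟩
  obtain ⟨T, hT⟩ := E.exists_forall_ge_hasBlock hbyz (r + 1)
  filter_upwards [Filter.eventually_ge_atTop (max T (max t₁ GST + Δ))] with t ht v hv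
  have hbv : b ∈ E.dag v t :=
    E.mono v hv ((le_max_right _ _).trans ht) (E.delivery _ hL v hv t₁ b hbt hba)
  have hex : ∃ b ∈ slotBlocks (E.dag v t) r l, SupportedLeader (E.dag v t) b := by
    refine ⟨b, mem_slotBlocks.2 ⟨hbv, hbr, hba⟩,
      (four_mul_add_one_le_card_compl hbyz).trans (card_le_authorCount fun w hw => ?_)⟩
    have hw := Finset.mem_compl.1 hw
    obtain ⟨c, hc, hca, hcr⟩ := hT t ((le_max_left _ _).trans ht) v hv w hw
    have hcw := E.mem_dag_author hv hc (hca ▸ hw)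
    rw [hca] at hcw
    exact ⟨c, hc, ⟨by rw [hcr, hbr], hsupp w hw t c hcw hca hcr⟩, hca⟩
  have hcommit : directDecide (E.dag v t) r l = .commit hex.choose := by
    unfold directDecide
    exact dif_pos hex
  -- the honest leader has only one block in its slot
  obtain ⟨hcD, hcr, hca⟩ := mem_slotBlocks.1 (mem_slotBlocks_of_directDecide hcommit)
  rw [hcommit, E.eq_of_author_round hv hL hcD hbt (hca ▸ hL) (hca.trans hba.symm)
    (hcr.trans hbr.symm)]

theorem Execution.eventually_decided (hbyz : byz.card ≤ f) (hk : 1 ≤ k) (r : ℕ) :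
    ∀ᶠ t in Filter.atTop, ∀ v ∉ byz, r ≤ (E.dag v t).sup Block.round ∧
      ∀ e ∈ tryDecide k (E.dag v t), e.round ≤ r → e.status ≠ .undecided := by
  obtain ⟨R₀, hR₀⟩ := E.exists_afterGST
  obtain ⟨R, hR, -, h0, h1⟩ := exists_consecutive_honest_leaders byz hbyz (max R₀ (r + 1))
  rw [max_le_iff] at hR
  obtain ⟨b, -, -, -, hb⟩ := E.eventually_directDecide hbyz (hR₀ R hR.1) hk h0
  obtain ⟨b', -, -, -, hb'⟩ := E.eventually_directDecide hbyz (hR₀ (R + 1) (by omega)) hk h1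
  filter_upwards [hb, hb'] with t ht ht' v hv
  refine ⟨?_, fun e he her => status_ne_undecided hk (ht v hv) (ht' v hv) he (by omega)⟩
  obtain ⟨hD, hr, -⟩ := mem_slotBlocks.1 (mem_slotBlocks_of_directDecide (ht v hv))
  have : R ≤ (E.dag v t).sup Block.round := hr ▸ Finset.le_sup (f := Block.round) hD
  omega

theorem Execution.eventually_committed (hbyz : byz.card ≤ f) (hk : 1 ≤ k) {r : ℕ}
    (hr : E.AfterGST r) {l : ℕ} (hl : l < k) (hL : leader f r l ∉ byz) :
    ∃ b : Blk f P, b.author = leader f r l ∧ b.round = r ∧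
      (∀ v ∉ byz, ∀ t, ∀ c ∈ E.dag v t, c.author = v → c.round = r + 1 → Supports c b) ∧
      ∀ᶠ t in Filter.atTop, ∀ v ∉ byz,
        directDecide (E.dag v t) r l = .commit b ∧ slotStatus k (E.dag v t) r l = .commit b ∧
          b ∈ commitSequence k (E.dag v t) := by
  obtain ⟨b, hba, hbr, hsupp, hdirect⟩ := E.eventually_directDecide hbyz hr hl hL
  refine ⟨b, hba, hbr, hsupp, ?_⟩
  filter_upwards [hdirect, E.eventually_decided hbyz hk r] with t ht hdec v hv
  obtain ⟨hsup, hdec⟩ := hdec v hv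
  obtain ⟨e, he, her, hel, hst⟩ := exists_slotStatus_eq hsup hl
  have hcommit : e.status = .commit b :=
    status_eq_commit (tryDecide_eq_entries (k := k) ▸ he) (her ▸ hel ▸ ht v hv)
  exact ⟨ht v hv, hst.trans hcommit,
    mem_commitSequence he hcommit fun e' he' h => hdec e' he' (h.trans her.le)⟩

end Execution

end Odontoceti

theorem mainTheorem2 (f : ℕ) (P : Type) (k : ℕ) (hk1 : 1 ≤ k) (hk2 : k ≤ 4 * f + 1)
    (Δ GST : ℝ≥0) (hΔ : 0 < Δ)
    (byz : Finset (Odontoceti.Validator f)) (hbyz : byz.card ≤ f) :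
    -- every window of `2 f + 2` rounds has two consecutive rounds with honest top-ranked leaders
    (∀ s : ℕ, ∃ r, s ≤ r ∧ r + 1 < s + (2 * f + 2) ∧
      Odontoceti.leader f r 0 ∉ byz ∧ Odontoceti.leader f (r + 1) 0 ∉ byz) ∧
    ∀ E : Odontoceti.Execution f P k Δ GST byz,
      -- every honest validator produces a block in every round
      (∀ v ∉ byz, ∀ r, ∃ t, Odontoceti.HasBlock (E.dag v t) v r) ∧
      -- all but finitely many rounds fall after GST
      (∃ R, ∀ r, R ≤ r → E.AfterGST r) ∧
      -- leader blocks of honest validators in rounds after GST are supported by all honest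
      -- validators, directly committed by all of them, and enter their leader sequences
      (∀ r, E.AfterGST r → ∀ l < k, Odontoceti.leader f r l ∉ byz →
        ∃ b : Odontoceti.Blk f P, b.author = Odontoceti.leader f r l ∧ b.round = r ∧
          (∀ v ∉ byz, ∀ t, ∀ c ∈ E.dag v t, c.author = v → c.round = r + 1 →
            Odontoceti.Supports c b) ∧
          ∀ᶠ t in Filter.atTop, ∀ v ∉ byz,
            Odontoceti.directDecide (E.dag v t) r l = .commit b ∧
            Odontoceti.slotStatus k (E.dag v t) r l = .commit b ∧
            b ∈ Odontoceti.commitSequence k (E.dag v t)) ∧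
      -- every leader slot is eventually decided by all honest validators
      (∀ r, ∀ l < k, ∀ᶠ t in Filter.atTop, ∀ v ∉ byz,
        Odontoceti.slotStatus k (E.dag v t) r l ≠ .undecided) ∧
      -- in every window of `2 f + 2` rounds after GST, leader blocks of two consecutive rounds are
      -- committed by all honest validators
      (∀ s, E.AfterGST s → ∃ r, s ≤ r ∧ r + 1 < s + (2 * f + 2) ∧
        ∃ b b' : Odontoceti.Blk f P,
          b.author = Odontoceti.leader f r 0 ∧ b.round = r ∧ b.author ∉ byz ∧
          b'.author = Odontoceti.leader f (r + 1) 0 ∧ b'.round = r + 1 ∧ b'.author ∉ byz ∧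
          ∀ᶠ t in Filter.atTop, ∀ v ∉ byz,
            Odontoceti.directDecide (E.dag v t) r 0 = .commit b ∧
            Odontoceti.directDecide (E.dag v t) (r + 1) 0 = .commit b' ∧
            b ∈ Odontoceti.commitSequence k (E.dag v t) ∧
            b' ∈ Odontoceti.commitSequence k (E.dag v t)) := by
  refine ⟨fun s => Odontoceti.exists_consecutive_honest_leaders byz hbyz s, fun E => ?_⟩
  have hlead := fun r (hr : E.AfterGST r) l (hl : l < k) hL =>
    E.eventually_committed hbyz hk1 hr hl hL
  refine ⟨fun v hv r => E.exists_hasBlock hbyz r v hv, E.exists_afterGST, ?_, ?_, ?_⟩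
  · intro r hr l hl hL
    obtain ⟨b, hb, hbr, hsupp, hev⟩ := hlead r hr l hl hL
    exact ⟨b, hb, hbr, hsupp, hev⟩
  · intro r l hl
    filter_upwards [E.eventually_decided hbyz hk1 r] with t ht v hv
    obtain ⟨hsup, hdec⟩ := ht v hv
    obtain ⟨e, he, her, -, hst⟩ := Odontoceti.exists_slotStatus_eq (D := E.dag v t) hsup hl
    rw [hst]
    exact hdec e he her.le
  · intro s hs
    obtain ⟨r, hsr, hrs, h0, h1⟩ := Odontoceti.exists_consecutive_honest_leaders byz hbyz s
    obtain ⟨b, hb, hbr, -, hev⟩ := hlead r (hs.mono hsr) 0 hk1 h0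
    obtain ⟨b', hb', hbr', -, hev'⟩ := hlead (r + 1) (hs.mono (by omega)) 0 hk1 h1
    refine ⟨r, hsr, hrs, b, b', hb, hbr, hb ▸ h0, hb', hbr', hb' ▸ h1, ?_⟩
    filter_upwards [hev, hev'] with t ht ht' v hv
    exact ⟨(ht v hv).1, (ht' v hv).1, (ht v hv).2.2, (ht' v hv).2.2⟩
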